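/- For an integer $k\ge 2$ and vectors $g=(g_1,\dots,g_k)$, $f=(f_1,\dots,f_k)$ of real numbers let $$\psi(g,f)=\sum_{\sigma\in S_k} g_{\sigma(1)}g_{\sigma(2)}\cdots g_{\sigma(k-2)}\,f_{\sigma(k-1)},$$ where $S_k$ is the group of permutations of $\{1,\dots,k\}$, and let $\Psi(p;q)=\psi(p,q)+\psi(q,p)$, where $p=(p_1,\dots,p_k)$ and $q=(q_1,\dots,q_k)$ range over the probability vectors of length $k$ (nonnegative coordinates with sum $1$). Then: (1) For $k=5$ the global maximum of $\Psi$ is $\frac{15(48+\sqrt5)}{1936}\approx 0.389226$ (rounded to six decimals), and it is attained at the pair of probability vectors $p=(0,\tfrac14,\tfrac14,\tfrac14,\tfrac14)$, $q=(\gamma,\delta,\delta,\delta,\delta)$ with $\delta=\frac{4+\sqrt5}{44}$ and $\gamma=1-4\delta$. (2) For $k=6$ the global maximum of $\Psi$ is $\frac{24}{125}=0.192$, and it is attained at the pair of probability vectors $p=(1,0,0,0,0,0)$, $q=(0,\tfrac15,\tfrac15,\tfrac15,\tfrac15,\tfrac15)$. -/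

import Mathlib

/-- `ψ(g,f) = ∑_{σ ∈ S_k} g_{σ(1)} ⋯ g_{σ(k-2)} f_{σ(k-1)}` for vectors of length `k = m + 2`.
With indices starting at `0`, the positions `1, …, k-2` are the first `m` elements of
`Fin (m + 2)`, and the position `k-1` is the element of value `m`. -/
def psi {m : ℕ} (g f : Fin (m + 2) → ℝ) : ℝ :=
  ∑ σ : Equiv.Perm (Fin (m + 2)),
    (∏ i : Fin m, g (σ (Fin.castAdd 2 i))) * f (σ (Fin.natAdd m 0))

/-- `Ψ(p;q) = ψ(p,q) + ψ(q,p)`. -/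
def bigPsi {m : ℕ} (p q : Fin (m + 2) → ℝ) : ℝ :=
  psi p q + psi q p

/-- The set of values of `Ψ` over pairs of probability vectors of length `k = m + 2`. -/
def bigPsiValues (m : ℕ) : Set ℝ :=
  {x | ∃ p ∈ stdSimplex ℝ (Fin (m + 2)), ∃ q ∈ stdSimplex ℝ (Fin (m + 2)), bigPsi p q = x}

/-! Every monomial of `Ψ` uses each coordinate at most once. So if `p` and `q` each agree at
coordinates `i` and `j`, moving masses `x` and `y` between these changes `Ψ` by `-(P x² + Q y² + R x
y)` with `P, Q, R ≥ 0` (`HasTransferExpansion`). Among the maximizers take one with least sum of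
squares, and compare it with the pair averaged over `i, j`. If the form is nonnegative, averaging
loses nothing, so minimality forces agreement at `i, j`. If it is negative, then `x y < 0`, and
moving further from the average increases `Ψ` unless a zero entry blocks it
(`exists_coordBalanced_maximizer`). Balance leaves, up to permutation, step vectors with four real
parameters and class sizes `a, b` (`CoordBalanced.exists_stepVec`), hence finitely many polynomial
inequalities. For `k = 5` the maximum lies in the case `a = 1`, `b = 0`, a cubic in one variable. -/

/-! ### From sums over permutations to sums over pairs -/

theorem exists_perm_apply_eq_and_apply_eq {α : Type*} [DecidableEq α] {a b j l : α}
    (hab : a ≠ b) (hjl : j ≠ l) : ∃ τ : Equiv.Perm α, τ a = j ∧ τ b = l := by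
  refine ⟨(Equiv.swap b (Equiv.swap a j l)).trans (Equiv.swap a j), ?_, by simp⟩
  have h1 : a ≠ Equiv.swap a j l := by
    intro h
    have := congrArg (Equiv.swap a j) h
    simp at this
    exact hjl this
  simp [Equiv.swap_apply_of_ne_of_ne hab h1]

open scoped Nat in
/-- Summing a function of the values at two distinct positions over all permutations. -/
theorem sum_perm_two_values {α : Type*} [Fintype α] [DecidableEq α] (h : α → α → ℝ) {a b : α}
    (hab : a ≠ b) :
    (∑ j : α, ∑ l : α, if j = l then (0 : ℝ) else 1) * ∑ σ : Equiv.Perm α, h (σ a) (σ b) =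
      (Fintype.card α)! * ∑ j, ∑ l, if j = l then 0 else h j l := by
  -- Right translation of the symmetric group carries `(a, b)` to any other pair of distinct
  -- positions, so one may average over all pairs.
  have key : ∀ j l : α, j ≠ l →
      ∑ σ : Equiv.Perm α, h (σ a) (σ b) = ∑ σ : Equiv.Perm α, h (σ j) (σ l) := by
    intro j l hjl
    obtain ⟨τ, hτa, hτb⟩ := exists_perm_apply_eq_and_apply_eq hab hjl
    rw [← Equiv.sum_comp (Equiv.mulRight τ) (fun σ : Equiv.Perm α => h (σ a) (σ b))]
    simp [hτa, hτb]
  calc (∑ j : α, ∑ l : α, if j = l then (0 : ℝ) else 1) * ∑ σ : Equiv.Perm α, h (σ a) (σ b)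
      = ∑ j, ∑ l, ∑ σ : Equiv.Perm α, if σ j = σ l then 0 else h (σ j) (σ l) := by
        simp only [Finset.sum_mul]
        refine Finset.sum_congr rfl fun j _ => Finset.sum_congr rfl fun l _ => ?_
        by_cases hjl : j = l
        · simp [hjl]
        · simp [hjl, key j l hjl]
    _ = ∑ σ : Equiv.Perm α, ∑ j, ∑ l, if σ j = σ l then 0 else h (σ j) (σ l) := by
        rw [Finset.sum_comm]
        conv_lhs => enter [2, x]; rw [Finset.sum_comm]
        rw [Finset.sum_comm]
        conv_rhs => enter [2, x]; rw [Finset.sum_comm]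
    _ = ∑ σ : Equiv.Perm α, ∑ j, ∑ l, if j = l then 0 else h j l := by
        refine Finset.sum_congr rfl fun σ _ => ?_
        rw [← Equiv.sum_comp σ (fun j => ∑ l, if j = l then 0 else h j l)]
        refine Finset.sum_congr rfl fun j _ => ?_
        rw [← Equiv.sum_comp σ (fun l => if σ j = l then 0 else h (σ j) l)]
    _ = _ := by simp [Fintype.card_perm]

/-- Up to a constant, `ψ` is the sum over ordered pairs `(j, l)` of `f j ∏_{x ≠ j, l} g x`. -/
def pairSum {n : ℕ} (g f : Fin n → ℝ) : ℝ :=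
  ∑ j, ∑ l, if j = l then 0 else f j * ∏ x, if x = j ∨ x = l then 1 else g x

-- A summand of `ψ` depends only on the values of `σ` at the last two positions, and each ordered
-- pair of distinct values comes from `m!` permutations.
open scoped Nat in
theorem psi_eq_pairSum {m : ℕ} (g f : Fin (m + 2) → ℝ) : psi g f = m ! * pairSum g f := by
  have h := sum_perm_two_values
    (fun j l : Fin (m + 2) => f j * ∏ x, if x = j ∨ x = l then 1 else g x)
    (a := Fin.natAdd m 0) (b := Fin.natAdd m 1) (by simp [Fin.ext_iff])
  have hpsi : psi g f = ∑ σ : Equiv.Perm (Fin (m + 2)),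
      f (σ (Fin.natAdd m 0)) * ∏ x, if x = σ (Fin.natAdd m 0) ∨ x = σ (Fin.natAdd m 1) then 1
        else g x := by
    refine Finset.sum_congr rfl fun σ _ => ?_
    rw [mul_comm, ← Equiv.prod_comp σ (fun x => if x = σ (Fin.natAdd m 0) ∨
      x = σ (Fin.natAdd m 1) then 1 else g x), Fin.prod_univ_add]
    simp only [EmbeddingLike.apply_eq_iff_eq, Fin.prod_univ_two, true_or, or_true, if_true, mul_one]
    congr 1
    refine Finset.prod_congr rfl fun i _ => ?_
    rw [if_neg]
    have := i.2
    simp only [Fin.ext_iff, Fin.val_castAdd, Fin.val_natAdd, Fin.val_zero, Fin.val_one]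
    omega
  have hcount : (∑ j : Fin (m + 2), ∑ l : Fin (m + 2), if j = l then (0 : ℝ) else 1) =
      (m + 2) * (m + 1) := by
    have : ∀ j : Fin (m + 2), (∑ l : Fin (m + 2), if j = l then (0 : ℝ) else 1) = m + 1 := by
      intro j
      have h2 : ∀ l : Fin (m + 2), (if j = l then (0 : ℝ) else 1) = 1 - if j = l then 1 else 0 := by
        intro l; split_ifs <;> simp
      simp only [h2, Finset.sum_sub_distrib]
      simp
      ring
    simp [this]
    ring
  rw [← hpsi, hcount, Fintype.card_fin, Nat.factorial_succ, Nat.factorial_succ] at h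
  push_cast at h
  have hpos : ((m : ℝ) + 2) * (m + 1) ≠ 0 := by positivity
  apply mul_left_cancel₀ hpos
  rw [h, pairSum]
  ring

theorem pairSum_comp_perm {n : ℕ} (g f : Fin n → ℝ) (τ : Equiv.Perm (Fin n)) :
    pairSum (g ∘ τ) (f ∘ τ) = pairSum g f := by
  unfold pairSum
  rw [← Equiv.sum_comp τ (fun j => ∑ l, if j = l then 0 else
    f j * ∏ x, if x = j ∨ x = l then 1 else g x)]
  refine Finset.sum_congr rfl fun j _ => ?_
  rw [← Equiv.sum_comp τ (fun l => if τ j = l then 0 else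
    f (τ j) * ∏ x, if x = τ j ∨ x = l then 1 else g x)]
  refine Finset.sum_congr rfl fun l _ => ?_
  rw [← Equiv.prod_comp τ (fun x => if x = τ j ∨ x = τ l then 1 else g x)]
  simp

theorem bigPsi_comp_perm {m : ℕ} (p q : Fin (m + 2) → ℝ) (τ : Equiv.Perm (Fin (m + 2))) :
    bigPsi (p ∘ τ) (q ∘ τ) = bigPsi p q := by
  simp only [bigPsi, psi_eq_pairSum, pairSum_comp_perm]

theorem bigPsi_comm {m : ℕ} (p q : Fin (m + 2) → ℝ) : bigPsi p q = bigPsi q p :=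
  add_comm _ _

theorem continuous_bigPsi {m : ℕ} :
    Continuous fun z : (Fin (m + 2) → ℝ) × (Fin (m + 2) → ℝ) => bigPsi z.1 z.2 := by
  unfold bigPsi psi
  fun_prop

theorem pairSum_five (g f : Fin 5 → ℝ) : pairSum g f =
    f 0 * (g 1 * g 2 * g 3 + g 1 * g 2 * g 4 + g 1 * g 3 * g 4 + g 2 * g 3 * g 4) +
    f 1 * (g 0 * g 2 * g 3 + g 0 * g 2 * g 4 + g 0 * g 3 * g 4 + g 2 * g 3 * g 4) +
    f 2 * (g 0 * g 1 * g 3 + g 0 * g 1 * g 4 + g 0 * g 3 * g 4 + g 1 * g 3 * g 4) +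
    f 3 * (g 0 * g 1 * g 2 + g 0 * g 1 * g 4 + g 0 * g 2 * g 4 + g 1 * g 2 * g 4) +
    f 4 * (g 0 * g 1 * g 2 + g 0 * g 1 * g 3 + g 0 * g 2 * g 3 + g 1 * g 2 * g 3) := by
  simp only [pairSum, Fin.sum_univ_five, Fin.prod_univ_five, Fin.reduceEq, or_false,
    false_or, or_self, if_true, if_false, one_mul, mul_one]
  ring

theorem pairSum_six (g f : Fin 6 → ℝ) : pairSum g f =
    f 0 * (g 1 * g 2 * g 3 * g 4 + g 1 * g 2 * g 3 * g 5 + g 1 * g 2 * g 4 * g 5 +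
      g 1 * g 3 * g 4 * g 5 + g 2 * g 3 * g 4 * g 5) +
    f 1 * (g 0 * g 2 * g 3 * g 4 + g 0 * g 2 * g 3 * g 5 + g 0 * g 2 * g 4 * g 5 +
      g 0 * g 3 * g 4 * g 5 + g 2 * g 3 * g 4 * g 5) +
    f 2 * (g 0 * g 1 * g 3 * g 4 + g 0 * g 1 * g 3 * g 5 + g 0 * g 1 * g 4 * g 5 +
      g 0 * g 3 * g 4 * g 5 + g 1 * g 3 * g 4 * g 5) +
    f 3 * (g 0 * g 1 * g 2 * g 4 + g 0 * g 1 * g 2 * g 5 + g 0 * g 1 * g 4 * g 5 +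
      g 0 * g 2 * g 4 * g 5 + g 1 * g 2 * g 4 * g 5) +
    f 4 * (g 0 * g 1 * g 2 * g 3 + g 0 * g 1 * g 2 * g 5 + g 0 * g 1 * g 3 * g 5 +
      g 0 * g 2 * g 3 * g 5 + g 1 * g 2 * g 3 * g 5) +
    f 5 * (g 0 * g 1 * g 2 * g 3 + g 0 * g 1 * g 2 * g 4 + g 0 * g 1 * g 3 * g 4 +
      g 0 * g 2 * g 3 * g 4 + g 1 * g 2 * g 3 * g 4) := by
  simp only [pairSum, Fin.sum_univ_six, Fin.prod_univ_six, Fin.reduceEq, or_false,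
    false_or, or_self, if_true, if_false, one_mul, mul_one]
  ring

/-! ### Mass transfer and balanced maximizers -/

/-- The direction that moves mass from coordinate `j` to coordinate `i`. -/
def transferDir {n : ℕ} (i j : Fin n) : Fin n → ℝ := Pi.single i 1 - Pi.single j 1

/-- Starting from a pair of vectors whose coordinates `i` and `j` agree, the transfer of mass
between these coordinates changes `F` by a quadratic form with nonpositive coefficients. -/
def HasTransferExpansion {n : ℕ} (F : (Fin n → ℝ) → (Fin n → ℝ) → ℝ) (i j : Fin n) : Prop :=
  ∀ p q : Fin n → ℝ, (∀ l, 0 ≤ p l) → (∀ l, 0 ≤ q l) → p i = p j → q i = q j →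
    ∃ P Q R : ℝ, 0 ≤ P ∧ 0 ≤ Q ∧ 0 ≤ R ∧ ∀ x y : ℝ,
      F (p + x • transferDir i j) (q + y • transferDir i j) =
        F p q - (P * x ^ 2 + Q * y ^ 2 + R * (x * y))

/-- Any two coordinates either agree in both vectors, or are strictly ordered in opposite ways
by the two vectors while one of the four entries vanishes. -/
def CoordBalanced {n : ℕ} (p q : Fin n → ℝ) : Prop :=
  ∀ i j, (p i = p j ∧ q i = q j) ∨
    ((p i - p j) * (q i - q j) < 0 ∧ (p i = 0 ∨ p j = 0 ∨ q i = 0 ∨ q j = 0))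

theorem HasTransferExpansion.of_perm {n : ℕ} {F : (Fin n → ℝ) → (Fin n → ℝ) → ℝ}
    (hF : ∀ p q (τ : Equiv.Perm (Fin n)), F (p ∘ τ) (q ∘ τ) = F p q) {a b i j : Fin n}
    (hab : a ≠ b) (hij : i ≠ j) (h : HasTransferExpansion F a b) :
    HasTransferExpansion F i j := by
  obtain ⟨τ, rfl, rfl⟩ := exists_perm_apply_eq_and_apply_eq hab hij
  intro p q hp hq hpij hqij
  obtain ⟨P, Q, R, hP, hQ, hR, H⟩ :=
    h (p ∘ τ) (q ∘ τ) (fun l => hp _) (fun l => hq _) hpij hqij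
  refine ⟨P, Q, R, hP, hQ, hR, fun x y => ?_⟩
  have hd : transferDir (τ a) (τ b) ∘ τ = transferDir a b := by
    ext l
    simp [transferDir, Pi.single_apply]
  have hcomp : ∀ (r : Fin n → ℝ) (x : ℝ),
      (r + x • transferDir (τ a) (τ b)) ∘ τ = r ∘ τ + x • transferDir a b := by
    intro r x
    rw [← hd]
    rfl
  rw [← hF _ _ τ, hcomp, hcomp, H, hF]

theorem sum_transferDir {n : ℕ} (i j : Fin n) : ∑ l, transferDir i j l = 0 := by
  simp [transferDir]

theorem sum_add_smul_transferDir_sq {n : ℕ} {i j : Fin n} (hij : i ≠ j) (r : Fin n → ℝ) (x : ℝ) :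
    ∑ l, (r + x • transferDir i j) l ^ 2 =
      ∑ l, r l ^ 2 + 2 * x * (r i - r j) + 2 * x ^ 2 := by
  have h : ∀ l, (r + x • transferDir i j) l ^ 2 = r l ^ 2 +
      ((Pi.single i (1 : ℝ) : Fin n → ℝ) l * (2 * x * r l + x ^ 2) +
        (Pi.single j (1 : ℝ) : Fin n → ℝ) l * (-2 * x * r l + x ^ 2)) := by
    intro l
    by_cases h1 : l = i
    · subst h1
      simp [transferDir, hij]
      ring
    · by_cases h2 : l = j
      · subst h2
        simp [transferDir, h1]
        ring
      · simp [transferDir, h1, h2]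
  simp only [h, Finset.sum_add_distrib, Pi.single_apply, ite_mul, one_mul, zero_mul,
    Finset.sum_ite_eq', Finset.mem_univ, if_true]
  ring

theorem add_smul_transferDir_mem_stdSimplex {n : ℕ} {i j : Fin n} (hij : i ≠ j) {r : Fin n → ℝ}
    (hr : r ∈ stdSimplex ℝ (Fin n)) {x : ℝ} (hi : 0 ≤ r i + x) (hj : 0 ≤ r j - x) :
    r + x • transferDir i j ∈ stdSimplex ℝ (Fin n) := by
  refine ⟨fun l => ?_, ?_⟩
  · by_cases h1 : l = i
    · subst h1
      simpa [transferDir, hij] using hi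
    · by_cases h2 : l = j
      · subst h2
        simpa [transferDir, h1, ← sub_eq_add_neg] using hj
      · simpa [transferDir, h1, h2] using hr.1 l
  · simp only [Pi.add_apply, Pi.smul_apply, smul_eq_mul, Finset.sum_add_distrib, hr.2,
      ← Finset.mul_sum, sum_transferDir, mul_zero, add_zero]

theorem exists_coordBalanced_maximizer {n : ℕ} [NeZero n] {F : (Fin n → ℝ) → (Fin n → ℝ) → ℝ}
    (hcont : Continuous fun z : (Fin n → ℝ) × (Fin n → ℝ) => F z.1 z.2)
    (hF : ∀ i j, i ≠ j → HasTransferExpansion F i j) :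
    ∃ p ∈ stdSimplex ℝ (Fin n), ∃ q ∈ stdSimplex ℝ (Fin n), CoordBalanced p q ∧
      ∀ p' ∈ stdSimplex ℝ (Fin n), ∀ q' ∈ stdSimplex ℝ (Fin n), F p' q' ≤ F p q := by
  let K : Set ((Fin n → ℝ) × (Fin n → ℝ)) := stdSimplex ℝ (Fin n) ×ˢ stdSimplex ℝ (Fin n)
  have hK : IsCompact K := (isCompact_stdSimplex ℝ (Fin n)).prod (isCompact_stdSimplex ℝ (Fin n))
  have hne : K.Nonempty :=
    ⟨(Pi.single 0 1, Pi.single 0 1), single_mem_stdSimplex ℝ 0, single_mem_stdSimplex ℝ 0⟩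
  obtain ⟨z₀, hz₀, hmax₀⟩ := hK.exists_isMaxOn hne hcont.continuousOn
  -- Second optimization: least sum of squares among the maximizers.
  have hK' : IsCompact (K ∩ {z | F z.1 z.2 = F z₀.1 z₀.2}) :=
    hK.inter_right (isClosed_eq hcont continuous_const)
  have hE : Continuous fun z : (Fin n → ℝ) × (Fin n → ℝ) => ∑ l, z.1 l ^ 2 + ∑ l, z.2 l ^ 2 := by
    fun_prop
  obtain ⟨⟨p, q⟩, ⟨⟨hp, hq⟩, hpq⟩, hmin⟩ := hK'.exists_isMinOn ⟨z₀, hz₀, rfl⟩ hE.continuousOn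
  simp only [Set.mem_ofPred_eq] at hp hq hpq
  have hmax : ∀ p' ∈ stdSimplex ℝ (Fin n), ∀ q' ∈ stdSimplex ℝ (Fin n), F p' q' ≤ F p q := by
    intro p' hp' q' hq'
    rw [hpq]
    exact hmax₀ (show (p', q') ∈ K from ⟨hp', hq'⟩)
  refine ⟨p, hp, q, hq, fun i j => ?_, hmax⟩
  by_cases hij : i = j
  · subst hij; exact Or.inl ⟨rfl, rfl⟩
  set d := transferDir i j with hd
  have hdi : d i = 1 := by simp [hd, transferDir, hij]
  have hdj : d j = -1 := by simp [hd, transferDir, Ne.symm hij]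
  -- With half-differences, moving by `-x` and `-y` averages the two coordinates; moving back by `x`
  -- and `y` recovers `(p, q)`.
  obtain ⟨x, hx⟩ : ∃ x, x = (p i - p j) / 2 := ⟨_, rfl⟩
  obtain ⟨y, hy⟩ : ∃ y, y = (q i - q j) / 2 := ⟨_, rfl⟩
  have hp0 := hp.1
  have hq0 := hq.1
  have hpi := hp0 i
  have hpj := hp0 j
  have hqi := hq0 i
  have hqj := hq0 j
  have hp' : p + (-x) • d ∈ stdSimplex ℝ (Fin n) :=
    add_smul_transferDir_mem_stdSimplex hij hp (by linarith) (by linarith)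
  have hq' : q + (-y) • d ∈ stdSimplex ℝ (Fin n) :=
    add_smul_transferDir_mem_stdSimplex hij hq (by linarith) (by linarith)
  obtain ⟨P, Q, R, hP, hQ, hR, H⟩ := hF i j hij (p + (-x) • d) (q + (-y) • d) hp'.1 hq'.1
    (by simp [hdi, hdj]; linarith) (by simp [hdi, hdj]; linarith)
  have H0 : F p q = F (p + (-x) • d) (q + (-y) • d) -
      (P * x ^ 2 + Q * y ^ 2 + R * (x * y)) := by
    rw [← H x y]
    congr 1 <;> · rw [← hd]; module
  by_cases hD : 0 ≤ P * x ^ 2 + Q * y ^ 2 + R * (x * y)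
  · left
    have hFm : F (p + (-x) • d) (q + (-y) • d) = F p q :=
      le_antisymm (hmax _ hp' _ hq') (by linarith)
    have h1 := hmin (show (p + (-x) • d, q + (-y) • d) ∈ K ∩ {z | F z.1 z.2 = F z₀.1 z₀.2} from
      ⟨⟨hp', hq'⟩, hFm.trans hpq⟩)
    simp only [Set.mem_ofPred_eq] at h1
    -- Averaging lowers the sum of squares by `2 x² + 2 y²`.
    rw [hd, sum_add_smul_transferDir_sq hij, sum_add_smul_transferDir_sq hij] at h1
    have hx2 : p i - p j = 2 * x := by linarith
    have hy2 : q i - q j = 2 * y := by linarith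
    rw [hx2, hy2] at h1
    have hx0 : x = 0 := by nlinarith [sq_nonneg x, sq_nonneg y]
    have hy0 : y = 0 := by nlinarith [sq_nonneg x, sq_nonneg y]
    constructor <;> linarith
  · right
    have hxy : x * y < 0 := by
      by_contra hxy
      push Not at hxy
      exact hD (by positivity)
    refine ⟨by rw [show p i - p j = 2 * x by linarith, show q i - q j = 2 * y by linarith]
               linarith, ?_⟩
    by_contra! hpos
    obtain ⟨h1, h2, h3, h4⟩ := hpos
    have g1 := lt_of_le_of_ne hpi h1.symm
    have g2 := lt_of_le_of_ne hpj h2.symm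
    have g3 := lt_of_le_of_ne hqi h3.symm
    have g4 := lt_of_le_of_ne hqj h4.symm
    have le1 : ∀ r ∈ stdSimplex ℝ (Fin n), ∀ l, r l ≤ 1 := fun r hr l =>
      hr.2 ▸ Finset.single_le_sum (fun a _ => hr.1 a) (Finset.mem_univ l)
    have b1 := le1 p hp i
    have b2 := le1 p hp j
    have b3 := le1 q hq i
    have b4 := le1 q hq j
    obtain ⟨ε, hε, e1, e2, e3, e4⟩ : ∃ ε : ℝ, 0 < ε ∧ ε ≤ p i ∧ ε ≤ p j ∧ ε ≤ q i ∧ ε ≤ q j :=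
      ⟨min (min (p i) (p j)) (min (q i) (q j)), by positivity,
        (min_le_left _ _).trans (min_le_left _ _), (min_le_left _ _).trans (min_le_right _ _),
        (min_le_right _ _).trans (min_le_left _ _), (min_le_right _ _).trans (min_le_right _ _)⟩
    have hp2 : p + (ε * x) • d ∈ stdSimplex ℝ (Fin n) :=
      add_smul_transferDir_mem_stdSimplex hij hp (by nlinarith) (by nlinarith)
    have hq2 : q + (ε * y) • d ∈ stdSimplex ℝ (Fin n) :=
      add_smul_transferDir_mem_stdSimplex hij hq (by nlinarith) (by nlinarith)
    -- Scaling the displacement from the average by `1 + ε` multiplies the negative form by `(1 +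
    -- ε)²`, which would raise `F` above its maximum.
    have H1 := H ((1 + ε) * x) ((1 + ε) * y)
    rw [show p + (-x) • transferDir i j + ((1 + ε) * x) • transferDir i j = p + (ε * x) • d by
      rw [hd]; module, show q + (-y) • transferDir i j + ((1 + ε) * y) • transferDir i j =
        q + (ε * y) • d by rw [hd]; module] at H1
    have H2 := hmax _ hp2 _ hq2
    rw [H1, H0] at H2
    push Not at hD
    have H3 := mul_neg_of_pos_of_neg (show 0 < 2 * ε + ε ^ 2 by positivity) hD
    linarith

/-! ### Transfer expansions for `k = 5` and `k = 6` -/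

theorem hasTransferExpansion_bigPsi_five {i j : Fin (3 + 2)} (hij : i ≠ j) :
    HasTransferExpansion (bigPsi (m := 3)) i j := by
  refine .of_perm bigPsi_comp_perm (a := (0 : Fin 5)) (b := (1 : Fin 5)) (by decide) hij ?_
  intro p q hp hq hp1 hq1
  let F : ℝ → ℝ → ℝ := fun x y => 6 * (
    pairSum ![p 1 + x, p 1 - x, p 2, p 3, p 4]
      ![q 1 + y, q 1 - y, q 2, q 3, q 4] +
    pairSum ![q 1 + y, q 1 - y, q 2, q 3, q 4]
      ![p 1 + x, p 1 - x, p 2, p 3, p 4])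
  have hF : ∀ x y : ℝ, bigPsi (m := 3) (p + x • transferDir (0 : Fin 5) 1)
      (q + y • transferDir (0 : Fin 5) 1) = F x y := by
    intro x y
    have e : ∀ (r : Fin 5 → ℝ) (x : ℝ), r 0 = r 1 → r + x • transferDir (0 : Fin 5) 1 =
        ![r 1 + x, r 1 - x, r 2, r 3, r 4] := by
      intro r x hr
      ext l
      fin_cases l <;> simp [transferDir, hr, sub_eq_add_neg]
    rw [e p x hp1, e q y hq1, bigPsi, psi_eq_pairSum, psi_eq_pairSum]
    norm_num [Nat.factorial]
    simp only [F]
    ring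
  have hF0 := hF 0 0
  simp only [zero_smul, add_zero] at hF0
  have p1 := hp 1
  have p2 := hp 2
  have p3 := hp 3
  have p4 := hp 4
  have q1 := hq 1
  have q2 := hq 2
  have q3 := hq 3
  have q4 := hq 4
  -- The three coefficients are read off from the values at `(0,0)`, `(1,0)`, `(0,1)` and `(1,1)`.
  refine ⟨F 0 0 - F 1 0, F 0 0 - F 0 1, F 1 0 + F 0 1 - F 1 1 - F 0 0, ?_, ?_, ?_, fun x y => ?_⟩
  iterate 3
    simp only [F, pairSum_five, Matrix.cons_val]
    ring_nf
    positivity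
  rw [hF]
  erw [hF0]
  simp only [F, pairSum_five, Matrix.cons_val]
  ring

theorem hasTransferExpansion_bigPsi_six {i j : Fin (4 + 2)} (hij : i ≠ j) :
    HasTransferExpansion (bigPsi (m := 4)) i j := by
  refine .of_perm bigPsi_comp_perm (a := (0 : Fin 6)) (b := (1 : Fin 6)) (by decide) hij ?_
  intro p q hp hq hp1 hq1
  let F : ℝ → ℝ → ℝ := fun x y => 24 * (
    pairSum ![p 1 + x, p 1 - x, p 2, p 3, p 4, p 5]
      ![q 1 + y, q 1 - y, q 2, q 3, q 4, q 5] +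
    pairSum ![q 1 + y, q 1 - y, q 2, q 3, q 4, q 5]
      ![p 1 + x, p 1 - x, p 2, p 3, p 4, p 5])
  have hF : ∀ x y : ℝ, bigPsi (m := 4) (p + x • transferDir (0 : Fin 6) 1)
      (q + y • transferDir (0 : Fin 6) 1) = F x y := by
    intro x y
    have e : ∀ (r : Fin 6 → ℝ) (x : ℝ), r 0 = r 1 → r + x • transferDir (0 : Fin 6) 1 =
        ![r 1 + x, r 1 - x, r 2, r 3, r 4, r 5] := by
      intro r x hr
      ext l
      fin_cases l <;> simp [transferDir, hr, sub_eq_add_neg]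
    rw [e p x hp1, e q y hq1, bigPsi, psi_eq_pairSum, psi_eq_pairSum]
    norm_num [Nat.factorial]
    simp only [F]
    ring
  have hF0 := hF 0 0
  simp only [zero_smul, add_zero] at hF0
  have p1 := hp 1
  have p2 := hp 2
  have p3 := hp 3
  have p4 := hp 4
  have p5 := hp 5
  have q1 := hq 1
  have q2 := hq 2
  have q3 := hq 3
  have q4 := hq 4
  have q5 := hq 5
  refine ⟨F 0 0 - F 1 0, F 0 0 - F 0 1, F 1 0 + F 0 1 - F 1 1 - F 0 0, ?_, ?_, ?_, fun x y => ?_⟩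
  iterate 3
    simp only [F, pairSum_six, Matrix.cons_val]
    ring_nf
    positivity
  rw [hF]
  erw [hF0]
  simp only [F, pairSum_six, Matrix.cons_val]
  ring

/-! ### Balanced pairs are step vectors -/

/-- The vector with `a` entries `0`, then entries `w`, and finally `b` entries `w + t`. -/
def stepVec (n a b : ℕ) (w t : ℝ) : Fin n → ℝ := fun i =>
  if (i : ℕ) < a then 0 else if (i : ℕ) < n - b then w else w + t

/-- A balanced pair of nonnegative vectors is constant on the three classes of coordinates. -/
theorem CoordBalanced.exists_values {n : ℕ} {p q : Fin n → ℝ} (hp : ∀ i, 0 ≤ p i)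
    (hq : ∀ i, 0 ≤ q i) (h : CoordBalanced p q) :
    ∃ w t z s : ℝ, 0 ≤ w ∧ 0 ≤ t ∧ 0 ≤ z ∧ 0 ≤ s ∧
      (∀ i, p i = 0 → q i = z + s) ∧ (∀ i, p i ≠ 0 → q i = 0 → p i = w + t) ∧
      (∀ i, p i ≠ 0 → q i ≠ 0 → p i = w ∧ q i = z) := by
  obtain ⟨w, z, hw, hz, hC, hzA, hwB⟩ : ∃ w z : ℝ, 0 ≤ w ∧ 0 ≤ z ∧
      (∀ i, p i ≠ 0 → q i ≠ 0 → p i = w ∧ q i = z) ∧ (∀ i, p i = 0 → z ≤ q i) ∧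
      (∀ i, p i ≠ 0 → q i = 0 → w ≤ p i) := by
    by_cases hne : ∃ c, p c ≠ 0 ∧ q c ≠ 0
    · obtain ⟨c, hpc, hqc⟩ := hne
      have hpc' := lt_of_le_of_ne (hp c) hpc.symm
      have hqc' := lt_of_le_of_ne (hq c) hqc.symm
      refine ⟨p c, q c, hp c, hq c, fun i hpi hqi => ?_, fun i hpi => ?_, fun i hpi hqi => ?_⟩
      · rcases h i c with h1 | ⟨-, h1⟩
        · exact h1
        · tauto
      · rcases h i c with h1 | ⟨h1, -⟩
        · exact h1.2.ge
        · rw [hpi] at h1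
          nlinarith
      · rcases h i c with h1 | ⟨h1, -⟩
        · exact h1.1.ge
        · rw [hqi] at h1
          nlinarith
    -- Without coordinates where both entries are nonzero, the base levels are arbitrary lower
    -- bounds; zero serves.
    · push Not at hne
      exact ⟨0, 0, le_rfl, le_rfl, fun i h1 h2 => absurd (hne i h1) h2, fun i _ => hq i,
        fun i _ _ => hp i⟩
  obtain ⟨s, hs, hA⟩ : ∃ s : ℝ, 0 ≤ s ∧ ∀ i, p i = 0 → q i = z + s := by
    by_cases hne : ∃ c, p c = 0
    · obtain ⟨c, hpc⟩ := hne
      refine ⟨q c - z, sub_nonneg.2 (hzA c hpc), fun i hpi => ?_⟩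
      rcases h i c with h1 | ⟨h1, -⟩
      · rw [h1.2]; ring
      · simp [hpi, hpc] at h1
    · exact ⟨0, le_rfl, fun i hi => absurd ⟨i, hi⟩ hne⟩
  obtain ⟨t, ht, hB⟩ : ∃ t : ℝ, 0 ≤ t ∧ ∀ i, p i ≠ 0 → q i = 0 → p i = w + t := by
    by_cases hne : ∃ c, p c ≠ 0 ∧ q c = 0
    · obtain ⟨c, hpc, hqc⟩ := hne
      refine ⟨p c - w, sub_nonneg.2 (hwB c hpc hqc), fun i hpi hqi => ?_⟩
      rcases h i c with h1 | ⟨h1, -⟩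
      · rw [h1.1]; ring
      · simp [hqi, hqc] at h1
    · exact ⟨0, le_rfl, fun i hi hi' => absurd ⟨i, hi, hi'⟩ hne⟩
  exact ⟨w, t, z, s, hw, ht, hz, hs, hA, hB, hC⟩

theorem CoordBalanced.exists_stepVec {n : ℕ} {p q : Fin n → ℝ} (hp : ∀ i, 0 ≤ p i)
    (hq : ∀ i, 0 ≤ q i) (h : CoordBalanced p q) :
    ∃ (τ : Equiv.Perm (Fin n)) (a b : ℕ) (w t z s : ℝ), a + b ≤ n ∧
      0 ≤ w ∧ 0 ≤ t ∧ 0 ≤ z ∧ 0 ≤ s ∧ p ∘ τ = stepVec n a b w t ∧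
      q ∘ τ = stepVec n b a z s ∘ Fin.revPerm := by
  obtain ⟨w, t, z, s, hw, ht, hz, hs, hA, hB, hC⟩ := h.exists_values hp hq
  -- Sorting by `κ` puts the zeros of `p` first and the coordinates with `p ≠ 0`, `q = 0` last.
  let κ : Fin n → ℕ := fun i => if p i = 0 then 0 else if q i = 0 then 2 else 1
  let τ := Tuple.sort κ
  have hmono : Monotone (κ ∘ τ) := Tuple.monotone_sort κ
  set a := Finset.card {i | (κ ∘ τ) i ≤ 0} with ha
  set e := Finset.card {i | (κ ∘ τ) i ≤ 1} with he
  have hae : a ≤ e := Finset.card_le_card fun i hi => by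
    simp only [Finset.mem_filter_univ] at hi ⊢
    omega
  have hen : e ≤ n := (Finset.card_le_univ _).trans_eq (Fintype.card_fin n)
  have h0 : ∀ i : Fin n, (i : ℕ) < a ↔ p (τ i) = 0 := by
    intro i
    rw [ha, Tuple.lt_card_le_iff_apply_le_of_monotone hmono]
    simp only [κ, Function.comp]
    split_ifs <;> simp_all
  have h1 : ∀ i : Fin n, (i : ℕ) < e ↔ (p (τ i) = 0 ∨ q (τ i) ≠ 0) := by
    intro i
    rw [he, Tuple.lt_card_le_iff_apply_le_of_monotone hmono]
    simp only [κ, Function.comp]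
    split_ifs <;> simp_all
  refine ⟨τ, a, n - e, w, t, z, s, by omega, hw, ht, hz, hs, ?_, ?_⟩
  · ext i
    have hi := i.2
    have h1' := h1 i
    rw [show e = n - (n - e) by omega] at h1'
    simp only [stepVec, Function.comp, h0, h1']
    split_ifs with c1 c2
    · exact c1
    · exact (hC _ c1 (by tauto)).1
    · exact hB _ c1 (by tauto)
  · ext i
    have hi := i.2
    have e1 : ((Fin.revPerm i : Fin n) : ℕ) < n - e ↔ ¬ (i : ℕ) < e := by
      simp only [Fin.revPerm_apply, Fin.val_rev]; omega
    have e2 : ((Fin.revPerm i : Fin n) : ℕ) < n - a ↔ ¬ (i : ℕ) < a := by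
      simp only [Fin.revPerm_apply, Fin.val_rev]; omega
    simp only [stepVec, Function.comp, e1, e2, h0, h1]
    by_cases c1 : p (τ i) = 0
    · simp [c1, hA _ c1]
    · by_cases c2 : q (τ i) = 0
      · simp [c1, c2]
      · simp [c1, (hC _ c1 c2).2]

/-- It suffices to bound `Ψ` on pairs of step vectors. -/
theorem bigPsi_le_of_stepVec {m : ℕ} {M : ℝ}
    (hF : ∀ i j, i ≠ j → HasTransferExpansion (bigPsi (m := m)) i j)
    (hM : ∀ (a b : ℕ) (w t z s : ℝ), a + b ≤ m + 2 → b ≤ a →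
      0 ≤ w → 0 ≤ t → 0 ≤ z → 0 ≤ s →
      ∑ i, stepVec (m + 2) a b w t i = 1 → ∑ i, stepVec (m + 2) b a z s (Fin.rev i) = 1 →
      bigPsi (stepVec (m + 2) a b w t) (fun i => stepVec (m + 2) b a z s (Fin.rev i)) ≤ M)
    {p q : Fin (m + 2) → ℝ} (hp : p ∈ stdSimplex ℝ (Fin (m + 2)))
    (hq : q ∈ stdSimplex ℝ (Fin (m + 2))) : bigPsi p q ≤ M := by
  obtain ⟨p₀, hp₀, q₀, hq₀, hbal, hmax⟩ := exists_coordBalanced_maximizer continuous_bigPsi hF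
  refine (hmax p hp q hq).trans ?_
  obtain ⟨τ, a, b, w, t, z, s, hab, hw, ht, hz, hs, hpτ, hqτ⟩ := hbal.exists_stepVec hp₀.1 hq₀.1
  rw [← bigPsi_comp_perm p₀ q₀ τ, hpτ, hqτ]
  have hsp : ∑ i, stepVec (m + 2) a b w t i = 1 := by
    rw [← hpτ, ← hp₀.2]; exact Equiv.sum_comp τ p₀
  have hsq : ∑ i, stepVec (m + 2) b a z s (Fin.rev i) = 1 := by
    rw [← hq₀.2, ← Equiv.sum_comp τ q₀]
    exact Finset.sum_congr rfl fun i _ => (congrFun hqτ i).symm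
  rcases le_total b a with hba | hba
  · exact hM a b w t z s hab hba hw ht hz hs hsp hsq
  -- Exchanging the vectors and reversing the coordinates swaps `a` and `b`.
  · rw [bigPsi_comm, ← bigPsi_comp_perm _ _ Fin.revPerm]
    have := hM b a z s w t (by omega) hba hz hs hw ht
      (by rw [← hsq]; exact (Equiv.sum_comp Fin.revPerm (stepVec (m + 2) b a z s)).symm)
      (by rw [← hsp]; exact Equiv.sum_comp Fin.revPerm (stepVec (m + 2) a b w t))
    have hrev : (stepVec (m + 2) b a z s ∘ Fin.revPerm) ∘ Fin.revPerm = stepVec (m + 2) b a z s := by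
      funext i
      simp
    rw [hrev]
    exact this

/-! ### Polynomial inequalities for step vectors -/

/-- Powers of the coordinate sums make both sides homogeneous of bidegree `(3, 3)`. The constant is
a rational with `6 · 81/1250 = 0.3888` just below the maximum; the excluded case exceeds it. -/
theorem pairSum_stepVec_five_le {a b : ℕ} {w t z s : ℝ} (hab : a + b ≤ 5) (hba : b ≤ a)
    (h10 : ¬ (a = 1 ∧ b = 0))
    (hw : 0 ≤ w) (ht : 0 ≤ t) (hz : 0 ≤ z) (hs : 0 ≤ s) :
    pairSum (stepVec 5 a b w t) (fun i => stepVec 5 b a z s i.rev) *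
        (∑ i, stepVec 5 b a z s (Fin.rev i)) ^ 2 +
      pairSum (fun i => stepVec 5 b a z s (Fin.rev i)) (stepVec 5 a b w t) *
        (∑ i, stepVec 5 a b w t i) ^ 2 ≤
    81 / 1250 * (∑ i, stepVec 5 a b w t i) ^ 3 * (∑ i, stepVec 5 b a z s (Fin.rev i)) ^ 3 := by
  have ha : a ≤ 5 := by omega
  rw [← sub_nonneg, pairSum_five, pairSum_five, Fin.sum_univ_five, Fin.sum_univ_five]
  interval_cases a <;> interval_cases b <;> first | omega | skip
  all_goals
    simp [stepVec, -sub_nonneg] <;> ring_nf <;> try positivity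
  -- Case `a = b = 1`: what remains after subtracting these squares has nonnegative coefficients.
  · have h : 0 ≤ w * z * (9 * (w * z - t * s) ^ 2 + 6 * (2 * (w * z) - t * z - w * s) ^ 2 +
        47 / 10 * (t * z - w * s) ^ 2 + 7 * (t * w * (s - z) ^ 2 + s * z * (t - w) ^ 2)) := by
      positivity
    refine h.trans (sub_nonneg.1 ?_)
    ring_nf
    positivity
  -- Case `a = 2`, `b = 1`: only the coefficient of `w² t z² s` is compensated.
  · have h : 0 ≤ 6 * (w * z ^ 2 * s * (t - w) ^ 2) := by positivity
    refine h.trans (sub_nonneg.1 ?_)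
    ring_nf
    positivity

theorem pairSum_stepVec_six_le {a b : ℕ} {w t z s : ℝ} (hab : a + b ≤ 6) (hba : b ≤ a)
    (hw : 0 ≤ w) (ht : 0 ≤ t) (hz : 0 ≤ z) (hs : 0 ≤ s) :
    pairSum (stepVec 6 a b w t) (fun i => stepVec 6 b a z s i.rev) *
        (∑ i, stepVec 6 b a z s (Fin.rev i)) ^ 3 +
      pairSum (fun i => stepVec 6 b a z s (Fin.rev i)) (stepVec 6 a b w t) *
        (∑ i, stepVec 6 a b w t i) ^ 3 ≤
    1 / 125 * (∑ i, stepVec 6 a b w t i) ^ 4 * (∑ i, stepVec 6 b a z s (Fin.rev i)) ^ 4 := by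
  have ha : a ≤ 6 := by omega
  rw [← sub_nonneg, pairSum_six, pairSum_six, Fin.sum_univ_six, Fin.sum_univ_six]
  interval_cases a <;> interval_cases b <;> first | omega | skip
  all_goals
    simp [stepVec, -sub_nonneg] <;> ring_nf <;> try positivity
  -- Case `a = 1`, `b = 0`, with equality at `z = 0`, the stated maximizer with the two vectors
  -- exchanged.
  · have h : 0 ≤ 180 * (w ^ 4 * z ^ 2 * (s - z) ^ 2) := by positivity
    refine h.trans (sub_nonneg.1 ?_)
    ring_nf
    positivity
  -- Case `a = b = 1`.
  · have h : 0 ≤ 110 * (w ^ 2 * z ^ 3 * s * (t - w) ^ 2) := by positivity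
    refine h.trans (sub_nonneg.1 ?_)
    ring_nf
    positivity

/-! ### The maximal values -/

open scoped Nat in
theorem bigPsi_eq_pairSum {m : ℕ} (p q : Fin (m + 2) → ℝ) :
    bigPsi p q = m ! * (pairSum p q + pairSum q p) := by
  rw [bigPsi, psi_eq_pairSum, psi_eq_pairSum, mul_add]

theorem bigPsi_five_le {p q : Fin (3 + 2) → ℝ} (hp : p ∈ stdSimplex ℝ (Fin (3 + 2)))
    (hq : q ∈ stdSimplex ℝ (Fin (3 + 2))) : bigPsi p q ≤ 15 * (48 + √5) / 1936 := by
  have h5 : √5 ^ 2 = 5 := Real.sq_sqrt (by norm_num)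
  have hlow : 22 / 10 ≤ √5 := Real.le_sqrt_of_sq_le (by norm_num)
  refine bigPsi_le_of_stepVec (fun i j hij => hasTransferExpansion_bigPsi_five hij) ?_ hp hq
  intro a b w t z s hab hba hw ht hz hs hsp hsq
  rw [bigPsi_eq_pairSum]
  by_cases h10 : a = 1 ∧ b = 0
  · obtain ⟨rfl, rfl⟩ := h10
    norm_num only [Nat.factorial]
    rw [pairSum_five, pairSum_five]
    rw [Fin.sum_univ_five] at hsp hsq
    simp [stepVec] at hsp hsq ⊢
    have hw4 : w = 1 / 4 := by linarith
    have hs1 : s = 1 - 5 * z := by linarith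
    subst hw4 hs1
    -- The maximum minus `Ψ` is a cubic in `z` with a double root at `δ`; its third root is
    -- negative.
    have key : 0 ≤ 66 * ((z - (4 + √5) / 44) ^ 2 * (z + (√5 - 2) / 22)) := by
      have : 0 ≤ z + (√5 - 2) / 22 := by linarith
      positivity
    linear_combination key + (-198 / 1936 * z + 3 * (√5 + 6) / 1936) * h5
  · have h := pairSum_stepVec_five_le hab hba h10 hw ht hz hs
    rw [hsp, hsq] at h
    norm_num [Nat.factorial] at h ⊢
    linarith

theorem bigPsi_six_le {p q : Fin (4 + 2) → ℝ} (hp : p ∈ stdSimplex ℝ (Fin (4 + 2)))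
    (hq : q ∈ stdSimplex ℝ (Fin (4 + 2))) : bigPsi p q ≤ 24 / 125 := by
  refine bigPsi_le_of_stepVec (fun i j hij => hasTransferExpansion_bigPsi_six hij) ?_ hp hq
  intro a b w t z s hab hba hw ht hz hs hsp hsq
  have h := pairSum_stepVec_six_le hab hba hw ht hz hs
  rw [hsp, hsq] at h
  rw [bigPsi_eq_pairSum]
  norm_num [Nat.factorial] at h ⊢
  linarith

theorem mainTheorem2 (δ γ : ℝ) (hδ : δ = (4 + √5) / 44) (hγ : γ = 1 - 4 * δ) :
    -- `k = 5`
    (IsGreatest (bigPsiValues 3) (15 * (48 + √5) / 1936) ∧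
      |15 * (48 + √5) / 1936 - 0.389226| < 0.0000005 ∧
      ![0, 1 / 4, 1 / 4, 1 / 4, 1 / 4] ∈ stdSimplex ℝ (Fin 5) ∧
      ![γ, δ, δ, δ, δ] ∈ stdSimplex ℝ (Fin 5) ∧
      bigPsi (m := 3) ![0, 1 / 4, 1 / 4, 1 / 4, 1 / 4] ![γ, δ, δ, δ, δ]
        = 15 * (48 + √5) / 1936) ∧
    -- `k = 6`
    (IsGreatest (bigPsiValues 4) (24 / 125) ∧
      ![1, 0, 0, 0, 0, 0] ∈ stdSimplex ℝ (Fin 6) ∧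
      ![0, 1 / 5, 1 / 5, 1 / 5, 1 / 5, 1 / 5] ∈ stdSimplex ℝ (Fin 6) ∧
      bigPsi (m := 4) ![1, 0, 0, 0, 0, 0] ![0, 1 / 5, 1 / 5, 1 / 5, 1 / 5, 1 / 5]
        = 24 / 125) := by
  have h5 : √5 ^ 2 = 5 := Real.sq_sqrt (by norm_num)
  have hlow : 2.23606 < √5 := Real.lt_sqrt_of_sq_lt (by norm_num)
  have hupp : √5 < 2.23607 := (Real.sqrt_lt' (by norm_num)).2 (by norm_num)
  have hp5 : ![0, 1 / 4, 1 / 4, 1 / 4, 1 / 4] ∈ stdSimplex ℝ (Fin 5) := by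
    refine ⟨fun i => by fin_cases i <;> norm_num, ?_⟩
    simp [Fin.sum_univ_five]
    norm_num
  have hq5 : ![γ, δ, δ, δ, δ] ∈ stdSimplex ℝ (Fin 5) := by
    have hδ0 : 0 ≤ δ := by rw [hδ]; positivity
    have hγ0 : 0 ≤ γ := by rw [hγ, hδ]; linarith
    refine ⟨fun i => by fin_cases i <;> simpa, ?_⟩
    simp [Fin.sum_univ_five]
    linarith
  have hval5 : bigPsi (m := 3) ![0, 1 / 4, 1 / 4, 1 / 4, 1 / 4] ![γ, δ, δ, δ, δ]
      = 15 * (48 + √5) / 1936 := by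
    rw [bigPsi_eq_pairSum, pairSum_five, pairSum_five]
    norm_num only [Nat.factorial]
    simp only [Matrix.cons_val]
    subst hγ hδ
    linear_combination (-6 * (11 * (√5 + 12) / 44 ^ 3 - 3 / 44 ^ 2)) * h5
  have hp6 : ![1, 0, 0, 0, 0, 0] ∈ stdSimplex ℝ (Fin 6) := by
    refine ⟨fun i => by fin_cases i <;> norm_num, ?_⟩
    simp [Fin.sum_univ_six]
  have hq6 : ![0, 1 / 5, 1 / 5, 1 / 5, 1 / 5, 1 / 5] ∈ stdSimplex ℝ (Fin 6) := by
    refine ⟨fun i => by fin_cases i <;> norm_num, ?_⟩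
    simp [Fin.sum_univ_six]
    norm_num
  have hval6 : bigPsi (m := 4) ![1, 0, 0, 0, 0, 0] ![0, 1 / 5, 1 / 5, 1 / 5, 1 / 5, 1 / 5]
      = 24 / 125 := by
    rw [bigPsi_eq_pairSum, pairSum_six, pairSum_six]
    simp only [Matrix.cons_val]
    norm_num [Nat.factorial]
  refine ⟨⟨⟨⟨_, hp5, _, hq5, hval5⟩, ?_⟩, ?_, hp5, hq5, hval5⟩,
    ⟨⟨_, hp6, _, hq6, hval6⟩, ?_⟩, hp6, hq6, hval6⟩
  · rintro x ⟨p, hp, q, hq, rfl⟩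
    exact bigPsi_five_le hp hq
  · rw [abs_lt]
    constructor <;> linarith
  · rintro x ⟨p, hp, q, hq, rfl⟩
    exact bigPsi_six_le hp hq
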